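/- Let $n,k\ge 0$ be integers and let $\mu:\binom{[n]}{k}\to\mathbb{R}_{\ge 0}$ be a probability distribution on the $k$-element subsets of $[n]=\{1,\dots,n\}$, i.e. $\sum_S\mu(S)=1$. Suppose that its generating polynomial \[ g_\mu(z_1,\dots,z_n)=\sum_{S\in\binom{[n]}{k}}\mu(S)\prod_{i\in S}z_i \] is log-concave on $\mathbb{R}_{\ge 0}^n$, that is, $g_\mu(\lambda x+(1-\lambda)y)\ge g_\mu(x)^{\lambda}g_\mu(y)^{1-\lambda}$ for all $x,y\in\mathbb{R}_{\ge 0}^n$ and $\lambda\in(0,1)$. Then for every set $T\subseteq[n]$ of size $l\le k$, \[ \Pr_{S\sim\mu}[T\subseteq S]\;\le\;\alpha(k,l)\cdot\prod_{i\in T}\Pr_{S\sim\mu}[i\in S],\qquad \alpha(k,l)=\binom{k}{l}\left(\frac{l}{k}\right)^{l}, \] where $\alpha(k,0)=1$ by convention. Moreover, for all integers $0\le l\le k$ we have $\alpha(k,l)\le l^l/l!$ (with $0^0=1$) and $\alpha(k,l)\le e^l$, and in particular $\alpha(k,2)\le 2$ for all $k\ge 2$. -/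

import Mathlib

namespace SetDist

open MvPolynomial

/-- The family of all `k`-element subsets of an `n`-element ground set. -/
abbrev KSubset (n k : ℕ) : Type := {S : Finset (Fin n) // S.card = k}

/-- The generating polynomial `∑_S μ(S) ∏_{i ∈ S} z_i`. -/
noncomputable def genPoly {n k : ℕ} (μ : KSubset n k → ℝ) : MvPolynomial (Fin n) ℝ :=
  ∑ S : KSubset n k, C (μ S) * ∏ i ∈ S.1, X i

/-- A polynomial with nonnegative coefficients is log-concave if it is log-concave as a function
on the closed nonnegative orthant. -/
def IsLogConcave {n : ℕ} (g : MvPolynomial (Fin n) ℝ) : Prop :=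
  (∀ m, 0 ≤ g.coeff m) ∧
    ∀ x y : Fin n → ℝ, 0 ≤ x → 0 ≤ y → ∀ t : ℝ, 0 < t → t < 1 →
      eval x g ^ t * eval y g ^ (1 - t) ≤ eval (t • x + (1 - t) • y) g

/-- The probability of the event `E` when a `k`-element set is drawn from `μ`. -/
def prob {n k : ℕ} (μ : KSubset n k → ℝ) (E : Finset (Fin n) → Prop) [DecidablePred E] : ℝ :=
  ∑ S : KSubset n k with E S.1, μ S

/-- `α(k, l) = (k choose l) (l / k) ^ l`; for `l = 0` the value is `1`, also when `k = 0`. -/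
noncomputable def alpha (k l : ℕ) : ℝ := (k.choose l : ℝ) * ((l : ℝ) / (k : ℝ)) ^ l

end SetDist

/-! Write `g` for the generating polynomial and `p i` for the marginals. If `Pr[T ⊆ S] = 0` there is
nothing to prove; otherwise let `v` be `1 / p i` on `T` and `0` elsewhere, and let `c j` be the
`j`-th derivative of `g` along `v` at the all-ones point. Then `c 0 = 1` and `c 1 = l`, while
expanding `c l` gives at least `l! · Pr[T ⊆ S] / ∏ p i`. The theorem follows from `c l ≤ k (k - 1) ⋯
(k - l + 1) (c 1 / k) ^ l`, which telescopes from Newton-type inequalities between consecutive `c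
j`.

Each Newton inequality is reversed Cauchy–Schwarz for the Hessian of an iterated derivative along
`v`, applied to the all-ones vector and `v`. The Hessians of all coordinate derivatives are
hyperbolic because log-concavity survives sending variables to infinity
(`isHyperbolic_hess_moment`). Hyperbolicity passes to derivatives along `v` by a gluing argument for
sums of forms (`isHyperbolic_sum`). -/

namespace SetDist

open Finset

/-- The reversed Cauchy–Schwarz inequality: a symmetric form satisfies it if and only if it has at
most one positive eigenvalue. -/
def IsHyperbolic {V : Type*} [AddCommGroup V] [Module ℝ V] (B : LinearMap.BilinForm ℝ V) : Prop :=
  ∀ a b, 0 < B a a → B a a * B b b ≤ B a b ^ 2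

/-! ### Forms with at most one positive eigenvalue and their sums -/

section BilinForm

variable {V : Type*} [AddCommGroup V] [Module ℝ V] {B : LinearMap.BilinForm ℝ V}

/-- A form that is negative semidefinite on a hyperplane is hyperbolic. -/
theorem isHyperbolic_of_nonpos_on_ker (hB : ∀ a b, B a b = B b a) (ξ : V →ₗ[ℝ] ℝ)
    (h : ∀ b, ξ b = 0 → B b b ≤ 0) : IsHyperbolic B := by
  intro a b ha
  have hξ : ξ a ≠ 0 := fun h0 => absurd (h a h0) (not_le.2 ha)
  have key := h (b - (ξ b / ξ a) • a) (by simp [hξ])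
  generalize ξ b / ξ a = c at key
  simp only [map_sub, map_smul, LinearMap.sub_apply, LinearMap.smul_apply, smul_eq_mul,
    hB b a] at key
  nlinarith [sq_nonneg (B a b - c * B a a)]

/-- A hyperbolic form is negative semidefinite on the orthogonal complement of a vector in the
closed light cone, unless that vector is in the radical. -/
theorem IsHyperbolic.nonpos_of_orthogonal (hB : ∀ a b, B a b = B b a) (h : IsHyperbolic B)
    {u x : V} (hu : 0 ≤ B u u) (hux : B u x ≠ 0) {b : V} (hub : B u b = 0) : B b b ≤ 0 := by
  by_contra! hb
  -- Projecting `x` off `b` keeps its pairing with `u`. Moving along `u` then makes the square at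
  -- least `1`, so `b` and `y + K • u` are orthogonal and both positive, which hyperbolicity
  -- forbids.
  set y := x - (B b x / B b b) • b with hy
  have hby : B b y = 0 := by
    simp only [hy, map_sub, map_smul, smul_eq_mul]
    field_simp
    ring
  have huy : B u y = B u x := by simp [hy, hub]
  set K := (1 - B y y) / (2 * B u x) with hK
  have hbc : B b (y + K • u) = 0 := by simp [hby, hB b u, hub]
  have hcc : B (y + K • u) (y + K • u) = 1 + K ^ 2 * B u u := by
    have : 2 * K * B u x = 1 - B y y := by rw [hK]; field_simp
    simp only [map_add, map_smul, LinearMap.add_apply, LinearMap.smul_apply, smul_eq_mul, hB y u,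
      huy]
    linarith
  have := h b (y + K • u) hb
  rw [hbc, hcc] at this
  nlinarith [mul_nonneg (sq_nonneg K) hu]

theorem IsHyperbolic.smul (h : IsHyperbolic B) {c : ℝ} (hc : 0 < c) : IsHyperbolic (c • B) := by
  intro a b ha
  simp only [LinearMap.smul_apply, smul_eq_mul] at ha ⊢
  have := h a b (pos_of_mul_pos_right ha hc.le)
  nlinarith [mul_le_mul_of_nonneg_left this (sq_nonneg c)]

/-- The sum of two hyperbolic forms is hyperbolic when a functional is represented, with respect to
each of them, by a vector of its closed light cone. -/
theorem IsHyperbolic.add {B' : LinearMap.BilinForm ℝ V} (hB : ∀ a b, B a b = B b a)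
    (hB' : ∀ a b, B' a b = B' b a) (h : IsHyperbolic B) (h' : IsHyperbolic B') {u w x : V}
    (hu : 0 ≤ B u u) (hw : 0 ≤ B' w w) (huw : B u = B' w) (hx : B u x ≠ 0) :
    IsHyperbolic (B + B') := by
  refine isHyperbolic_of_nonpos_on_ker (fun a b => by simp [hB a b, hB' a b]) (B u) fun b hb => ?_
  have h1 := h.nonpos_of_orthogonal hB hu hx hb
  have h2 := h'.nonpos_of_orthogonal hB' hw (huw ▸ hx) (huw ▸ hb)
  simpa using add_nonpos h1 h2

/-- Positive combinations of the Hessians `H i` of the partial derivatives of a form are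
hyperbolic if each `H i` is. -/
theorem isHyperbolic_sum {ι : Type*} [DecidableEq ι] (H : ι → LinearMap.BilinForm ℝ V) (e : ι → V)
    (v : ι → ℝ) (x : V) (A : Finset ι) (hv : ∀ i ∈ A, 0 < v i)
    (hsymm : ∀ i a b, H i a b = H i b a) (hcomm : ∀ i j, H i (e j) = H j (e i))
    (hnn : ∀ i j k, 0 ≤ H i (e j) (e k)) (hhyp : ∀ i ∈ A, IsHyperbolic (H i))
    (hx : ∀ i ∈ A, ∀ j ∈ A, i ≠ j → 0 < H i (e j) x) :
    IsHyperbolic (∑ i ∈ A, v i • H i) := by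
  induction A using Finset.induction_on with
  | empty => intro a b h; simp at h
  | insert m A hm ih =>
    rw [sum_insert hm, add_comm]
    rcases A.eq_empty_or_nonempty with rfl | hA
    · simpa using (hhyp m (by simp)).smul (hv m (by simp))
    have hs : ∀ a b, (∑ i ∈ A, v i • H i) a b = (∑ i ∈ A, v i • H i) b a := fun a b => by
      simp [LinearMap.sum_apply, hsymm _ a b]
    have hvm := hv m (by simp)
    -- By `hcomm`, pairing `e m` under the partial sum and pairing `∑ v i • e i` under `H m` give
    -- the same functional; `(v m)⁻¹` cancels the weight of `H m`.
    refine IsHyperbolic.add (u := e m) (w := (v m)⁻¹ • ∑ i ∈ A, v i • e i) (x := x) hs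
      (fun a b => by simp [hsymm m a b])
      (ih (fun i hi => hv i (by simp [hi])) (fun i hi => hhyp i (by simp [hi]))
        fun i hi j hj => hx i (by simp [hi]) j (by simp [hj]))
      ((hhyp m (by simp)).smul hvm) ?_ ?_ ?_ ?_
    · simp only [LinearMap.sum_apply, LinearMap.smul_apply, smul_eq_mul]
      exact sum_nonneg fun i hi => mul_nonneg (hv i (by simp [hi])).le (hnn _ _ _)
    · simp only [map_smul, map_sum, LinearMap.sum_apply, LinearMap.smul_apply, smul_eq_mul]
      have hin : ∀ i ∈ A, 0 ≤ v i := fun i hi => (hv i (by simp [hi])).le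
      have hinv := (inv_pos.2 hvm).le
      refine mul_nonneg hinv (sum_nonneg fun i hi => mul_nonneg (hin i hi) ?_)
      refine mul_nonneg hinv (sum_nonneg fun j hj => mul_nonneg (hin j hj) ?_)
      exact mul_nonneg hvm.le (hnn _ _ _)
    · ext z
      simp only [map_smul, map_sum, LinearMap.sum_apply, LinearMap.smul_apply, smul_eq_mul]
      rw [mul_sum]
      exact sum_congr rfl fun i _ => by rw [hcomm]; field_simp
    · simp only [LinearMap.sum_apply, LinearMap.smul_apply, smul_eq_mul]
      exact (sum_pos (fun i hi => mul_pos (hv i (by simp [hi]))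
        (hx i (by simp [hi]) m (by simp) (by rintro rfl; exact hm hi))) hA).ne'

end BilinForm

/-! ### Directional derivatives and Newton inequalities -/

section Jet

theorem cons_le_val_of_notMem {ι : Type*} {T : Finset ι} {s : Multiset ι} {i : ι} (hs : s ≤ T.val)
    (hi : i ∈ T) (his : i ∉ s) : i ::ₘ s ≤ T.val :=
  (Multiset.le_iff_subset (Multiset.nodup_cons.2 ⟨his, Multiset.nodup_of_le hs T.nodup⟩)).2
    (Multiset.cons_subset.2 ⟨hi, Multiset.subset_of_le hs⟩)

variable {ι : Type*} [Fintype ι] [DecidableEq ι]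

/-- If `F s` is the value at a fixed point of the partial derivative indexed by the multiset `s`,
then `dirDeriv v F` is the same data for the directional derivative along `v`. -/
def dirDeriv (v : ι → ℝ) (F : Multiset ι → ℝ) (s : Multiset ι) : ℝ :=
  ∑ i, v i * F (i ::ₘ s)

/-- The Hessian of the partial derivative indexed by `s`. -/
noncomputable def hess (F : Multiset ι → ℝ) (s : Multiset ι) : LinearMap.BilinForm ℝ (ι → ℝ) :=
  Matrix.toBilin' (Matrix.of fun i j => F (i ::ₘ j ::ₘ s))

theorem hess_apply (F : Multiset ι → ℝ) (s : Multiset ι) (a b : ι → ℝ) :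
    hess F s a b = ∑ i, ∑ j, a i * F (i ::ₘ j ::ₘ s) * b j := by
  simp [hess, Matrix.toBilin'_apply]

theorem hess_symm (F : Multiset ι → ℝ) (s : Multiset ι) (a b : ι → ℝ) :
    hess F s a b = hess F s b a := by
  rw [hess_apply, hess_apply, sum_comm]
  refine sum_congr rfl fun i _ => sum_congr rfl fun j _ => ?_
  rw [Multiset.cons_swap]
  ring

theorem hess_single (F : Multiset ι → ℝ) (s : Multiset ι) (i : ι) (b : ι → ℝ) :
    hess F s (Pi.single i 1) b = ∑ j, F (i ::ₘ j ::ₘ s) * b j := by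
  rw [hess_apply, sum_eq_single i] <;> simp +contextual

theorem hess_dirDeriv (v : ι → ℝ) (F : Multiset ι → ℝ) (s : Multiset ι) :
    hess (dirDeriv v F) s = ∑ i, v i • hess F (i ::ₘ s) := by
  refine LinearMap.ext fun a => LinearMap.ext fun b => ?_
  simp only [LinearMap.sum_apply, LinearMap.smul_apply, smul_eq_mul, hess_apply, dirDeriv, mul_sum,
    sum_mul]
  rw [sum_comm]
  conv_rhs => rw [sum_comm]
  rw [sum_comm]
  refine sum_congr rfl fun i _ => ?_
  rw [sum_comm]
  refine sum_congr rfl fun j _ => sum_congr rfl fun k _ => ?_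
  rw [Multiset.cons_swap j i, Multiset.cons_swap j k]
  ring

/-- The derivatives at the all-ones point of a homogeneous multiaffine polynomial of degree `d`
with nonnegative coefficients, all of whose derivatives along subsets of `T` of size at most `m`
are positive, and have hyperbolic Hessians as long as these are of order at most `m`. -/
structure HyperbolicJet (T : Finset ι) (m d : ℕ) (F : Multiset ι → ℝ) : Prop where
  le_degree : m ≤ d
  nonneg : ∀ s, 0 ≤ F s
  eq_zero : ∀ s, ¬ s.Nodup → F s = 0
  pos : ∀ s ≤ T.val, Multiset.card s ≤ m → 0 < F s
  euler : ∀ s, ∑ i, F (i ::ₘ s) = ((d : ℝ) - Multiset.card s) * F s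
  hyperbolic : ∀ s ≤ T.val, Multiset.card s + 2 ≤ m → IsHyperbolic (hess F s)

/-- The new Hessian is a positive combination of the Hessians at `i ::ₘ s` with `i ∈ T \ s`: other
terms vanish because `v` is supported on `T` and repeated derivatives are zero. Symmetry of third
derivatives and Euler's identity supply what `isHyperbolic_sum` needs, at the cost of one order. -/
theorem HyperbolicJet.dirDeriv {T : Finset ι} {m d : ℕ} {F : Multiset ι → ℝ}
    (h : HyperbolicJet T (m + 1) (d + 1) F) (hmT : m + 1 ≤ #T) {v : ι → ℝ}
    (hv : ∀ i ∈ T, 0 < v i) (hv0 : ∀ i ∉ T, v i = 0) :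
    HyperbolicJet T m d (dirDeriv v F) where
  le_degree := by have := h.le_degree; omega
  nonneg s := sum_nonneg fun i _ => mul_nonneg
    (if hi : i ∈ T then (hv i hi).le else (hv0 i hi).ge) (h.nonneg _)
  eq_zero s hs := sum_eq_zero fun i _ => by
    rw [h.eq_zero _ fun hn => hs (Multiset.nodup_cons.1 hn).2, mul_zero]
  pos s hs hc := by
    obtain ⟨i, hi, his⟩ : ∃ i ∈ T, i ∉ s.toFinset := by
      apply exists_mem_notMem_of_card_lt_card
      have := Multiset.toFinset_card_le s
      omega
    rw [Multiset.mem_toFinset] at his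
    refine lt_of_lt_of_le (mul_pos (hv i hi) (h.pos _ (cons_le_val_of_notMem hs hi his)
      (by simpa using hc))) (single_le_sum (f := fun i => v i * F (i ::ₘ s)) (fun j _ => mul_nonneg
        (if hj : j ∈ T then (hv j hj).le else (hv0 j hj).ge) (h.nonneg _)) (mem_univ i))
  euler s := by
    simp only [SetDist.dirDeriv]
    rw [sum_comm, mul_sum]
    refine sum_congr rfl fun i _ => ?_
    rw [← mul_sum]
    simp only [Multiset.cons_swap i]
    rw [h.euler]
    simp only [Multiset.card_cons]
    push_cast
    ring
  hyperbolic s hs hc := by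
    have hzero : ∀ i ∈ s, hess F (i ::ₘ s) = 0 := fun i hi => by
      refine LinearMap.ext fun a => LinearMap.ext fun b => ?_
      rw [hess_apply]
      refine sum_eq_zero fun j _ => sum_eq_zero fun k _ => ?_
      rw [h.eq_zero]
      · simp
      · simp [hi]
    have hsum : hess (SetDist.dirDeriv v F) s = ∑ i ∈ T \ s.toFinset, v i • hess F (i ::ₘ s) := by
      rw [hess_dirDeriv]
      symm
      refine sum_subset (subset_univ _) fun i _ hi => ?_
      by_cases hiT : i ∈ T
      · have : i ∈ s := by simpa [hiT] using hi
        rw [hzero i this, smul_zero]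
      · rw [hv0 i hiT, zero_smul]
    rw [hsum]
    have hmem : ∀ i ∈ T \ s.toFinset, i ∈ T ∧ i ∉ s := fun i hi => by simpa using hi
    refine isHyperbolic_sum (fun i => hess F (i ::ₘ s)) (fun i => Pi.single i 1) v 1 _
      (fun i hi => hv i (hmem i hi).1) (fun i => hess_symm F _) ?_ ?_ ?_ ?_
    · intro i j
      refine LinearMap.ext fun b => ?_
      simp only [hess_single]
      refine sum_congr rfl fun k _ => ?_
      rw [Multiset.cons_swap k i, Multiset.cons_swap j i, Multiset.cons_swap j k]
    · intro i j k
      rw [hess_single]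
      exact sum_nonneg fun r _ => mul_nonneg (h.nonneg _) (by
        rw [Pi.single_apply]; split_ifs <;> norm_num)
    · intro i hi
      exact h.hyperbolic _ (cons_le_val_of_notMem hs (hmem i hi).1 (hmem i hi).2)
        (by simp; omega)
    · intro i hi j hj hij
      rw [hess_single]
      simp only [Pi.one_apply, mul_one, Multiset.cons_swap j]
      rw [h.euler]
      have h1 := cons_le_val_of_notMem hs (hmem j hj).1 (hmem j hj).2
      refine mul_pos ?_ (h.pos _ (cons_le_val_of_notMem h1 (hmem i hi).1
        (by simp [hij, (hmem i hi).2])) (by simp; omega))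
      have := h.le_degree
      rw [sub_pos]
      simp only [Multiset.card_cons]
      norm_cast
      omega

theorem HyperbolicJet.iterate_dirDeriv {T : Finset ι} {m d : ℕ} {F : Multiset ι → ℝ} {v : ι → ℝ}
    (hv : ∀ i ∈ T, 0 < v i) (hv0 : ∀ i ∉ T, v i = 0) (j : ℕ)
    (h : HyperbolicJet T (m + j) (d + j) F) (hmT : m + j ≤ #T) :
    HyperbolicJet T m d ((SetDist.dirDeriv v)^[j] F) := by
  induction j generalizing F with
  | zero => exact h
  | succ j ih =>
    rw [Function.iterate_succ_apply]
    exact ih (HyperbolicJet.dirDeriv h hmT hv hv0) (by omega)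

/-- Reversed Cauchy–Schwarz for the all-ones vector and `v`, simplified by Euler's identity. -/
theorem HyperbolicJet.newton {T : Finset ι} {d : ℕ} {F : Multiset ι → ℝ}
    (h : HyperbolicJet T 2 d F) (v : ι → ℝ) :
    d * (F 0 * SetDist.dirDeriv v (SetDist.dirDeriv v F) 0) ≤
      ((d : ℝ) - 1) * SetDist.dirDeriv v F 0 ^ 2 := by
  have hd : (2 : ℝ) ≤ d := by exact_mod_cast h.le_degree
  have h0 : 0 < F 0 := h.pos 0 (Multiset.zero_le _) (by simp)
  have h1v : hess F 0 1 v = (d - 1) * SetDist.dirDeriv v F 0 := by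
    rw [hess_apply, sum_comm, SetDist.dirDeriv, mul_sum]
    refine sum_congr rfl fun j _ => ?_
    rw [← sum_mul]
    simp only [Pi.one_apply, one_mul]
    rw [h.euler]
    simp
    ring
  have h11 : hess F 0 1 1 = d * (d - 1) * F 0 := by
    have := h.euler 0
    rw [hess_apply, sum_comm]
    simp only [Pi.one_apply, one_mul, mul_one, h.euler, Multiset.card_cons, Multiset.card_zero]
    rw [← mul_sum, this]
    simp
    ring
  have hvv : hess F 0 v v = SetDist.dirDeriv v (SetDist.dirDeriv v F) 0 := by
    simp only [hess_apply, SetDist.dirDeriv, mul_sum]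
    refine sum_congr rfl fun j _ => sum_congr rfl fun k _ => ?_
    rw [Multiset.cons_swap]
    ring
  have key := h.hyperbolic 0 (Multiset.zero_le _) (by simp) 1 v
    (by rw [h11]; have : (0 : ℝ) < d - 1 := by linarith
        positivity)
  rw [h11, h1v, hvv] at key
  refine le_of_mul_le_mul_left ?_ (show (0 : ℝ) < d - 1 by linarith)
  linarith

/-- In the expansion of the iterated derivative, only the `(#A)!` orderings of `A` are kept; all
other terms are nonnegative. -/
theorem factorial_mul_le_iterate_dirDeriv {v : ι → ℝ} (hv : ∀ i, 0 ≤ v i) {F : Multiset ι → ℝ}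
    (hF : ∀ s, 0 ≤ F s) {T : Multiset ι} (A : Finset ι) (s : Multiset ι) (hs : s + A.val = T) :
    (#A).factorial * (∏ i ∈ A, v i) * F T ≤ (SetDist.dirDeriv v)^[#A] F s := by
  have hnn : ∀ j s, 0 ≤ (SetDist.dirDeriv v)^[j] F s := by
    intro j
    induction j with
    | zero => exact hF
    | succ j ih =>
      intro s
      rw [Function.iterate_succ_apply']
      exact sum_nonneg fun i _ => mul_nonneg (hv i) (ih _)
  induction hj : #A generalizing A s with
  | zero =>
    obtain rfl := card_eq_zero.1 hj
    simp at hs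
    simp [hs]
  | succ j ih =>
    rw [Function.iterate_succ_apply', SetDist.dirDeriv]
    calc ((j + 1).factorial * (∏ i ∈ A, v i) * F T : ℝ)
        = ∑ i ∈ A, v i * (j.factorial * (∏ i ∈ A.erase i, v i) * F T) := by
          rw [sum_congr rfl (g := fun i => (j.factorial * (∏ i ∈ A, v i) * F T : ℝ))]
          · rw [sum_const, hj, Nat.factorial_succ]
            simp
            ring
          · intro i hi
            rw [← mul_prod_erase A v hi]
            ring
      _ ≤ ∑ i ∈ A, v i * (SetDist.dirDeriv v)^[j] F (i ::ₘ s) := by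
          refine sum_le_sum fun i hi => mul_le_mul_of_nonneg_left (ih _ _ ?_ ?_) (hv i)
          · rw [← hs, erase_val, Multiset.cons_add, ← Multiset.add_cons,
              Multiset.cons_erase (by exact hi)]
          · rw [card_erase_of_mem hi, hj]; rfl
      _ ≤ _ := sum_le_sum_of_subset_of_nonneg (subset_univ _)
          fun i _ _ => mul_nonneg (hv i) (hnn _ _)

/-- Successive Newton inequalities bound the ratio of consecutive directional derivatives. -/
theorem HyperbolicJet.iterate_ratio {T : Finset ι} {k : ℕ} {F : Multiset ι → ℝ} {v : ι → ℝ}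
    (hv : ∀ i ∈ T, 0 < v i) (hv0 : ∀ i ∉ T, v i = 0) (h : HyperbolicJet T (#T) k F)
    (hF : F 0 = 1) (j : ℕ) (hj : j + 1 ≤ #T) :
    k * (SetDist.dirDeriv v)^[j + 1] F 0 ≤
      ((k : ℝ) - j) * SetDist.dirDeriv v F 0 * (SetDist.dirDeriv v)^[j] F 0 := by
  induction j with
  | zero => simp [hF]
  | succ j ih =>
    specialize ih (by omega)
    obtain ⟨d, rfl⟩ : ∃ d, k = d + j := ⟨k - j, by have := h.le_degree; omega⟩
    obtain ⟨m, hm⟩ : ∃ m, #T = m + 2 + j := ⟨#T - 2 - j, by omega⟩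
    have hjet : HyperbolicJet T (m + 2) d ((SetDist.dirDeriv v)^[j] F) :=
      HyperbolicJet.iterate_dirDeriv hv hv0 j (hm ▸ h) hm.ge
    have hjet2 : HyperbolicJet T 2 d ((SetDist.dirDeriv v)^[j] F) :=
      { hjet with
        le_degree := by have := hjet.le_degree; omega
        pos := fun s hs hc => hjet.pos s hs (by omega)
        hyperbolic := fun s hs hc => hjet.hyperbolic s hs (by omega) }
    have hN := hjet2.newton v
    have h0 : 0 < (SetDist.dirDeriv v)^[j] F 0 := hjet.pos 0 (Multiset.zero_le _) (by simp)
    have hd : (2 : ℝ) ≤ d := by exact_mod_cast hjet2.le_degree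
    rw [Function.iterate_succ_apply', Function.iterate_succ_apply'] at *
    have h1 : 0 ≤ SetDist.dirDeriv v ((SetDist.dirDeriv v)^[j] F) 0 := sum_nonneg fun i _ =>
      mul_nonneg (if hi : i ∈ T then (hv i hi).le else (hv0 i hi).ge) (hjet.nonneg _)
    generalize SetDist.dirDeriv v (SetDist.dirDeriv v ((SetDist.dirDeriv v)^[j] F)) 0 = c2 at *
    generalize SetDist.dirDeriv v ((SetDist.dirDeriv v)^[j] F) 0 = c1 at *
    generalize (SetDist.dirDeriv v)^[j] F 0 = c0 at *
    generalize SetDist.dirDeriv v F 0 = L at *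
    push_cast at *
    -- Newton's inequality bounds `c2` by `c1 ^ 2`; the induction hypothesis replaces one factor
    -- `c1` by a multiple of `L * c0`, and `d * c0` cancels.
    have hA : (d + j : ℝ) * (d * (c0 * c2)) ≤ (d + j) * ((d - 1) * c1 ^ 2) :=
      mul_le_mul_of_nonneg_left hN (by positivity)
    have hB := mul_le_mul_of_nonneg_left ih (mul_nonneg (show (0 : ℝ) ≤ d - 1 by linarith) h1)
    refine le_of_mul_le_mul_left ?_ (show (0 : ℝ) < d * c0 by positivity)
    linarith

theorem HyperbolicJet.iterate_le {T : Finset ι} {k : ℕ} {F : Multiset ι → ℝ} {v : ι → ℝ}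
    (hv : ∀ i ∈ T, 0 < v i) (hv0 : ∀ i ∉ T, v i = 0) (h : HyperbolicJet T (#T) k F)
    (hF : F 0 = 1) (j : ℕ) (hj : j ≤ #T) :
    (SetDist.dirDeriv v)^[j] F 0 ≤ k.descFactorial j * (SetDist.dirDeriv v F 0 / k) ^ j := by
  induction j with
  | zero => simp [hF]
  | succ j ih =>
    have hk := h.le_degree
    have hk0 : (0 : ℝ) < k := by exact_mod_cast (show 0 < k by omega)
    have hr := h.iterate_ratio hv hv0 hF j hj
    have h1 : 0 ≤ SetDist.dirDeriv v F 0 := sum_nonneg fun i _ =>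
      mul_nonneg (if hi : i ∈ T then (hv i hi).le else (hv0 i hi).ge) (h.nonneg _)
    have hkj : (0 : ℝ) ≤ (k : ℝ) - j := sub_nonneg.2 (by exact_mod_cast (show j ≤ k by omega))
    have := hr.trans (mul_le_mul_of_nonneg_left (ih (by omega)) (mul_nonneg hkj h1))
    rw [Nat.descFactorial_succ, pow_succ]
    push_cast [Nat.cast_sub (show j ≤ k by omega)]
    refine le_of_mul_le_mul_left (this.trans_eq ?_) hk0
    field_simp

end Jet

/-! ### Second-order expansion along a line -/

theorem exists_prod_one_add_mul {ι : Type*} (b : ι → ℝ) (A : Finset ι) :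
    ∃ r : Polynomial ℝ, ∀ t : ℝ, ∏ i ∈ A, (1 + t * b i) =
      1 + t * ∑ i ∈ A, b i + t ^ 2 * (((∑ i ∈ A, b i) ^ 2 - ∑ i ∈ A, b i ^ 2) / 2) +
        t ^ 3 * r.eval t := by
  classical
  induction A using Finset.induction_on with
  | empty => exact ⟨0, by simp⟩
  | insert m A hm ih =>
    obtain ⟨r, hr⟩ := ih
    refine ⟨Polynomial.C (b m * (((∑ i ∈ A, b i) ^ 2 - ∑ i ∈ A, b i ^ 2) / 2)) +
      (1 + Polynomial.X * Polynomial.C (b m)) * r, fun t => ?_⟩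
    rw [prod_insert hm, sum_insert hm, sum_insert hm, hr]
    simp only [Polynomial.eval_add, Polynomial.eval_mul, Polynomial.eval_C, Polynomial.eval_X,
      Polynomial.eval_one]
    ring

/-- The second-order condition for midpoint log-concavity at `0`. -/
theorem two_mul_le_sq_of_midpoint {c₀ c₁ c₂ δ : ℝ} (r : Polynomial ℝ) (hδ : 0 < δ) (φ : ℝ → ℝ)
    (hφ : ∀ t, φ t = c₀ + t * c₁ + t ^ 2 * c₂ + t ^ 3 * r.eval t)
    (h : ∀ t, 0 < t → t < δ → φ t * φ (-t) ≤ φ 0 ^ 2) : 2 * c₀ * c₂ ≤ c₁ ^ 2 := by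
  -- For `t ≠ 0` this is `(φ t * φ (-t) - φ 0 ^ 2) / t ^ 2`, written so as to be continuous at `0`.
  let ψ : ℝ → ℝ := fun t => 2 * c₀ * c₂ - c₁ ^ 2 + t ^ 2 * c₂ ^ 2 +
    t * (r.eval t * (c₀ - t * c₁ + t ^ 2 * c₂ - t ^ 3 * r.eval (-t)) -
      r.eval (-t) * (c₀ + t * c₁ + t ^ 2 * c₂))
  have hcont : Continuous ψ := by fun_prop
  have hlim : Filter.Tendsto ψ (nhdsWithin 0 (Set.Ioi 0)) (nhds (ψ 0)) :=
    hcont.continuousAt.tendsto.mono_left nhdsWithin_le_nhds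
  have hle : ψ 0 ≤ 0 := by
    refine le_of_tendsto hlim ?_
    filter_upwards [Ioo_mem_nhdsGT hδ] with t ht
    have := h t ht.1 ht.2
    rw [hφ, hφ (-t), hφ 0] at this
    refine nonpos_of_mul_nonpos_right (a := t ^ 2) ?_ (by have := ht.1; positivity)
    simp only [ψ]
    linarith
  simp [ψ] at hle
  linarith

/-! ### From log-concavity to hyperbolic Hessians -/

variable {n k : ℕ} {μ : KSubset n k → ℝ}

/-- The partial derivative of the generating polynomial along the set `A`, as a function. -/
def condGen (μ : KSubset n k → ℝ) (A : Finset (Fin n)) (x : Fin n → ℝ) : ℝ :=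
  ∑ S : KSubset n k, if A ⊆ S.1 then μ S * ∏ i ∈ S.1 \ A, x i else 0

theorem eval_genPoly (x : Fin n → ℝ) :
    MvPolynomial.eval x (genPoly μ) = ∑ S : KSubset n k, μ S * ∏ i ∈ S.1, x i := by
  simp [genPoly, map_sum, map_prod]

theorem IsLogConcave.eval_mul_eval_le (hμ : ∀ S, 0 ≤ μ S) (h : IsLogConcave (genPoly μ))
    {x y : Fin n → ℝ} (hx : 0 ≤ x) (hy : 0 ≤ y) :
    MvPolynomial.eval x (genPoly μ) * MvPolynomial.eval y (genPoly μ) ≤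
      MvPolynomial.eval (fun i => (x i + y i) / 2) (genPoly μ) ^ 2 := by
  have hnn : ∀ z : Fin n → ℝ, 0 ≤ z → 0 ≤ MvPolynomial.eval z (genPoly μ) := fun z hz => by
    rw [eval_genPoly]
    exact sum_nonneg fun S _ => mul_nonneg (hμ S) (prod_nonneg fun i _ => hz i)
  have key := h.2 x y hx hy (1 / 2) (by norm_num) (by norm_num)
  rw [show (1 / 2 : ℝ) • x + (1 - 1 / 2 : ℝ) • y = fun i => (x i + y i) / 2 by
    ext i; simp; ring, show (1 - 1 / 2 : ℝ) = 1 / 2 by norm_num, ← Real.sqrt_eq_rpow,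
    ← Real.sqrt_eq_rpow, ← Real.sqrt_mul (hnn x hx)] at key
  exact (Real.sqrt_le_left (hnn _ fun i => by
    have := hx i; have := hy i; simp at *; linarith)).1 key

/-- Sending the variables in `A` to infinity, log-concavity passes to the derivative along `A`. -/
theorem condGen_mul_condGen_le (hμ : ∀ S, 0 ≤ μ S) (h : IsLogConcave (genPoly μ))
    (A : Finset (Fin n)) {x y : Fin n → ℝ} (hx : 0 ≤ x) (hy : 0 ≤ y) :
    condGen μ A x * condGen μ A y ≤ condGen μ A (fun i => (x i + y i) / 2) ^ 2 := by
  -- For `ε > 0` this is `ε ^ #A` times `g` with `ε⁻¹` substituted on `A`; at `ε = 0` only the sets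
  -- containing `A` survive. Midpoints leave the value `ε⁻¹` unchanged.
  let f : ℝ → (Fin n → ℝ) → ℝ := fun ε z =>
    ∑ S : KSubset n k, μ S * (∏ i ∈ S.1 \ A, z i) * ε ^ #(A \ S.1)
  have hf0 : ∀ z, f 0 z = condGen μ A z := fun z => by
    refine sum_congr rfl fun S _ => ?_
    split_ifs with hS
    · simp [sdiff_eq_empty_iff_subset.2 hS]
    · rw [zero_pow, mul_zero]
      rwa [Ne, card_eq_zero, sdiff_eq_empty_iff_subset]
  have hfε : ∀ ε : ℝ, 0 < ε → ∀ z,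
      f ε z = MvPolynomial.eval (fun i => if i ∈ A then ε⁻¹ else z i) (genPoly μ) * ε ^ #A := by
    intro ε hε z
    rw [eval_genPoly, sum_mul]
    refine sum_congr rfl fun S _ => ?_
    rw [prod_ite, prod_const, filter_mem_eq_inter, filter_notMem_eq_sdiff,
      ← card_inter_add_card_sdiff A S.1, pow_add, inter_comm A S.1, inv_pow]
    field_simp
  have hcont : ∀ z, Continuous fun ε => f ε z := fun z => by fun_prop
  have hlim : ∀ φ : ℝ → ℝ, Continuous φ →
      Filter.Tendsto φ (nhdsWithin 0 (Set.Ioi 0)) (nhds (φ 0)) := fun φ hφ =>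
    hφ.continuousAt.tendsto.mono_left nhdsWithin_le_nhds
  simp only [← hf0]
  refine le_of_tendsto_of_tendsto (hlim _ ((hcont x).mul (hcont y))) (hlim _ ((hcont _).pow 2)) ?_
  filter_upwards [self_mem_nhdsWithin] with ε hε
  have hε : 0 < ε := hε
  have hext : ∀ z : Fin n → ℝ, 0 ≤ z → (0 : Fin n → ℝ) ≤ fun i => if i ∈ A then ε⁻¹ else z i :=
    fun z hz i => by
      have := hz i
      have := hε.le
      simp only [Pi.zero_apply]
      split_ifs
      · positivity
      · assumption
  have key := h.eval_mul_eval_le hμ (hext x hx) (hext y hy)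
  rw [show (fun i => ((if i ∈ A then ε⁻¹ else x i) + (if i ∈ A then ε⁻¹ else y i)) / 2) =
    fun i => if i ∈ A then ε⁻¹ else (x i + y i) / 2 by ext i; split_ifs <;> ring] at key
  rw [Pi.mul_apply, Pi.pow_apply, hfε ε hε, hfε ε hε, hfε ε hε]
  have := mul_le_mul_of_nonneg_right key (show 0 ≤ (ε ^ #A) ^ 2 by positivity)
  linarith

/-- The derivatives of the generating polynomial at the all-ones point. -/
def moment (μ : KSubset n k → ℝ) (s : Multiset (Fin n)) : ℝ :=
  ∑ S : KSubset n k, if s ≤ S.1.val then μ S else 0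

theorem moment_nonneg (hμ : ∀ S, 0 ≤ μ S) (s : Multiset (Fin n)) : 0 ≤ moment μ s :=
  sum_nonneg fun S _ => by split_ifs; exacts [hμ S, le_rfl]

theorem moment_anti (hμ : ∀ S, 0 ≤ μ S) {s t : Multiset (Fin n)} (hst : s ≤ t) :
    moment μ t ≤ moment μ s :=
  sum_le_sum fun S _ => by
    by_cases ht : t ≤ S.1.val
    · rw [if_pos ht, if_pos (hst.trans ht)]
    · rw [if_neg ht]; split_ifs; exacts [hμ S, le_rfl]

theorem moment_eq_zero {s : Multiset (Fin n)} (hs : ¬ s.Nodup) : moment μ s = 0 :=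
  sum_eq_zero fun S _ => if_neg fun h => hs (Multiset.nodup_of_le h S.1.nodup)

theorem cons_le_val_iff {ι : Type*} [DecidableEq ι] {A S : Finset ι} (hA : A ⊆ S) (i : ι) :
    i ::ₘ A.val ≤ S.val ↔ i ∈ S \ A := by
  constructor
  · intro h
    have hn := Multiset.nodup_cons.1 (Multiset.nodup_of_le h S.nodup)
    exact mem_sdiff.2 ⟨Multiset.subset_of_le h (by simp), hn.1⟩
  · intro h
    exact cons_le_val_of_notMem (val_le_iff.2 hA) (mem_sdiff.1 h).1 (mem_sdiff.1 h).2

theorem not_cons_le_val {ι : Type*} {s t : Multiset ι} (h : ¬ s ≤ t) (i : ι) : ¬ i ::ₘ s ≤ t :=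
  fun h' => h ((Multiset.le_cons_self s i).trans h')

theorem sum_mul_moment_cons (A : Finset (Fin n)) (b : Fin n → ℝ) :
    ∑ i, moment μ (i ::ₘ A.val) * b i =
      ∑ S : KSubset n k, if A ⊆ S.1 then μ S * ∑ i ∈ S.1 \ A, b i else 0 := by
  simp only [moment, sum_mul]
  rw [sum_comm]
  refine sum_congr rfl fun S _ => ?_
  split_ifs with hS
  · simp only [cons_le_val_iff hS, ite_mul, zero_mul, ← sum_filter, mul_sum]
    exact sum_congr (by ext; simp) fun _ _ => rfl
  · exact sum_eq_zero fun i _ => by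
      rw [if_neg (not_cons_le_val (by rwa [val_le_iff]) i), zero_mul]

theorem moment_euler (s : Multiset (Fin n)) :
    ∑ i, moment μ (i ::ₘ s) = ((k : ℝ) - Multiset.card s) * moment μ s := by
  by_cases hs : s.Nodup
  · obtain ⟨A, rfl⟩ : ∃ A : Finset (Fin n), s = A.val := ⟨⟨s, hs⟩, rfl⟩
    have := sum_mul_moment_cons (μ := μ) A 1
    simp only [Pi.one_apply, mul_one] at this
    rw [this, moment, mul_sum]
    refine sum_congr rfl fun S _ => ?_
    simp only [val_le_iff]
    split_ifs with hS
    · rw [sum_const, card_sdiff_of_subset hS, S.2, nsmul_one,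
        Nat.cast_sub (by rw [← S.2]; exact card_le_card hS), mul_comm]
      rfl
    · simp
  · rw [moment_eq_zero hs, mul_zero]
    exact sum_eq_zero fun i _ => moment_eq_zero fun h => hs (Multiset.nodup_cons.1 h).2

theorem hess_moment (A : Finset (Fin n)) (b : Fin n → ℝ) :
    hess (moment μ) A.val b b = ∑ S : KSubset n k, if A ⊆ S.1 then
      μ S * ((∑ i ∈ S.1 \ A, b i) ^ 2 - ∑ i ∈ S.1 \ A, b i ^ 2) else 0 := by
  rw [hess_apply]
  have hrow : ∀ j, ∑ i, b i * moment μ (i ::ₘ j ::ₘ A.val) * b j =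
      ∑ S : KSubset n k, if A ⊆ S.1 then
        (if j ∈ S.1 \ A then μ S * (b j * ∑ i ∈ S.1 \ A, b i - b j ^ 2) else 0) else 0 := by
    intro j
    by_cases hj : j ∈ A
    · rw [sum_eq_zero fun i _ => by rw [moment_eq_zero (by simp [hj])]; simp, sum_eq_zero]
      intro S _
      simp [hj]
    have hval : j ::ₘ A.val = (insert j A).val := by rw [insert_val_of_notMem hj]
    have := sum_mul_moment_cons (μ := μ) (insert j A) b
    rw [← hval] at this
    rw [← sum_mul, sum_congr rfl fun i _ => mul_comm (b i) _, this, sum_mul]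
    refine sum_congr rfl fun S _ => ?_
    by_cases hS : A ⊆ S.1
    · by_cases hjS : j ∈ S.1
      · rw [if_pos (insert_subset hjS hS), if_pos hS, if_pos (by simp [hj, hjS]),
          sdiff_insert, ← add_sum_erase (S.1 \ A) b (a := j) (by simp [hj, hjS])]
        ring
      · rw [if_neg fun h => hjS (h (mem_insert_self _ _)), if_pos hS, if_neg (by simp [hjS]),
          zero_mul]
    · rw [if_neg fun h => hS ((subset_insert _ _).trans h), if_neg hS, zero_mul]
  rw [sum_comm, sum_congr rfl fun j _ => hrow j, sum_comm]
  refine sum_congr rfl fun S _ => ?_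
  split_ifs with hS
  · rw [← sum_filter, filter_mem_eq_inter, univ_inter, ← mul_sum, sum_sub_distrib, ← sum_mul, sq]
  · simp

/-- Midpoint log-concavity of the derivative along `A`, restricted to the line `1 + t * b`, bounds
value times second derivative by the square of the first. On the kernel `ξ` of the gradient the
latter is zero, so the Hessian is nonpositive there. -/
theorem isHyperbolic_hess_moment (hμ : ∀ S, 0 ≤ μ S) (h : IsLogConcave (genPoly μ))
    (s : Multiset (Fin n)) : IsHyperbolic (hess (moment μ) s) := by
  have hzero : moment μ s = 0 → IsHyperbolic (hess (moment μ) s) := by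
    intro h0 a b ha
    rw [hess_apply, sum_eq_zero fun i _ => sum_eq_zero fun j _ => ?_] at ha
    · exact absurd ha (lt_irrefl _)
    · rw [le_antisymm ((moment_anti hμ ((Multiset.le_cons_self s j).trans
        (Multiset.le_cons_self _ i))).trans_eq h0) (moment_nonneg hμ _)]
      simp
  by_cases hs : s.Nodup
  swap
  · exact hzero (moment_eq_zero hs)
  rcases (moment_nonneg hμ s).eq_or_lt with h0 | hpos
  · exact hzero h0.symm
  obtain ⟨A, rfl⟩ : ∃ A : Finset (Fin n), s = A.val := ⟨⟨s, hs⟩, rfl⟩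
  let ξ : (Fin n → ℝ) →ₗ[ℝ] ℝ := ∑ i, moment μ (i ::ₘ A.val) • LinearMap.proj i
  have hξ : ∀ b, ξ b = ∑ i, moment μ (i ::ₘ A.val) * b i := fun b => by
    simp [ξ, LinearMap.sum_apply]
  refine isHyperbolic_of_nonpos_on_ker (hess_symm _ _) ξ fun b hb => ?_
  suffices hsuff : 2 * moment μ A.val * (hess (moment μ) A.val b b / 2) ≤ ξ b ^ 2 by
    rw [hb] at hsuff
    refine nonpos_of_mul_nonpos_right (a := moment μ A.val) ?_ hpos
    linarith
  choose r hr using fun S : KSubset n k => exists_prod_one_add_mul b (S.1 \ A)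
  -- For `t` below this bound, both `1 + t * b` and `1 - t * b` stay in the nonnegative orthant.
  have hδ : 0 < (1 + ∑ i, |b i|)⁻¹ := by positivity
  refine two_mul_le_sq_of_midpoint
    (∑ S : KSubset n k, if A ⊆ S.1 then Polynomial.C (μ S) * r S else 0) hδ
    (fun t => condGen μ A fun i => 1 + t * b i) (fun t => ?_) fun t ht0 ht => ?_
  · rw [hξ, sum_mul_moment_cons, hess_moment, Polynomial.eval_finsetSum, moment, condGen,
      sum_div, mul_sum, mul_sum, mul_sum, ← sum_add_distrib, ← sum_add_distrib, ← sum_add_distrib]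
    refine sum_congr rfl fun S _ => ?_
    simp only [val_le_iff]
    split_ifs with hS
    · rw [hr]
      simp only [Polynomial.eval_mul, Polynomial.eval_C]
      ring
    · simp
  · have hb : ∀ i, |t * b i| ≤ 1 := fun i => by
      rw [abs_mul, abs_of_pos ht0]
      have h1 : |b i| ≤ ∑ i, |b i| := single_le_sum (f := fun i => |b i|)
        (fun j _ => abs_nonneg _) (mem_univ i)
      have h2 := mul_le_mul ht.le (show |b i| ≤ 1 + ∑ i, |b i| by linarith) (abs_nonneg _) hδ.le
      rwa [inv_mul_cancel₀ (by positivity)] at h2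
    have key := condGen_mul_condGen_le hμ h A (x := fun i => 1 + t * b i)
      (y := fun i => 1 + -t * b i)
      (fun i => by have := neg_le_of_abs_le (hb i); simp; linarith)
      (fun i => by have := le_of_abs_le (hb i); simp; linarith)
    refine key.trans_eq ?_
    congr 2
    ext i
    ring

theorem moment_val (T : Finset (Fin n)) : moment μ T.val = prob μ (fun S => T ⊆ S) := by
  simp [moment, prob, sum_filter, val_le_iff]

theorem moment_singleton (i : Fin n) : moment μ {i} = prob μ (fun S => i ∈ S) := by
  simp [moment, prob, sum_filter]

/-! ### The correlation inequality and the bounds on `alpha` -/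

theorem prob_subset_le (hμ : μ ∈ stdSimplex ℝ (KSubset n k)) (h : IsLogConcave (genPoly μ))
    (T : Finset (Fin n)) (hT : #T ≤ k) :
    prob μ (fun S => T ⊆ S) ≤ alpha k #T * ∏ i ∈ T, prob μ (fun S => i ∈ S) := by
  simp only [← moment_val, ← moment_singleton]
  have hnn := moment_nonneg hμ.1
  rcases (hnn T.val).eq_or_lt with h0 | hpos
  · rw [← h0]
    exact mul_nonneg (by unfold alpha; positivity) (prod_nonneg fun i _ => hnn _)
  have hp : ∀ i ∈ T, 0 < moment μ {i} := fun i hi =>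
    hpos.trans_le (moment_anti hμ.1 (by simpa using hi))
  -- With these weights each `i ∈ T` contributes exactly `1` to the first derivative, which is
  -- therefore `#T`.
  let v : Fin n → ℝ := fun i => if i ∈ T then (moment μ {i})⁻¹ else 0
  have hv : ∀ i ∈ T, 0 < v i := fun i hi => by simpa [v, hi] using hp i hi
  have hv0 : ∀ i ∉ T, v i = 0 := fun i hi => by simp [v, hi]
  have hvn : ∀ i, 0 ≤ v i := fun i => if hi : i ∈ T then (hv i hi).le else (hv0 i hi).ge
  have hjet : HyperbolicJet T #T k (moment μ) :=
    { le_degree := hT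
      nonneg := hnn
      eq_zero := fun s => moment_eq_zero
      pos := fun s hs _ => hpos.trans_le (moment_anti hμ.1 hs)
      euler := moment_euler
      hyperbolic := fun s _ _ => isHyperbolic_hess_moment hμ.1 h s }
  have hone : moment μ 0 = 1 := by simpa [moment] using hμ.2
  have hdir : dirDeriv v (moment μ) 0 = #T := by
    rw [dirDeriv, ← sum_subset (subset_univ T) fun i _ hi => by rw [hv0 i hi, zero_mul],
      sum_congr rfl (g := fun _ => (1 : ℝ)) fun i hi => ?_]
    · simp
    · simpa [v, hi] using inv_mul_cancel₀ (hp i hi).ne'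
  have hle := (factorial_mul_le_iterate_dirDeriv hvn hnn T 0 (zero_add _)).trans
    (hjet.iterate_le hv hv0 hone _ le_rfl)
  have hprod : ∏ i ∈ T, v i = (∏ i ∈ T, moment μ {i})⁻¹ := by
    rw [← prod_inv_distrib]
    exact prod_congr rfl fun i hi => by simp [v, hi]
  have hP : 0 < ∏ i ∈ T, moment μ {i} := prod_pos hp
  rw [hdir, hprod, Nat.descFactorial_eq_factorial_mul_choose, Nat.cast_mul, mul_assoc,
    mul_assoc] at hle
  have := le_of_mul_le_mul_left hle (by positivity)
  rwa [inv_mul_le_iff₀ hP, mul_comm] at this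

theorem alpha_le_pow_div_factorial {k l : ℕ} (h : l ≤ k) :
    alpha k l ≤ (l : ℝ) ^ l / (l.factorial : ℝ) := by
  rcases k.eq_zero_or_pos with rfl | hk
  · obtain rfl := Nat.le_zero.1 h
    simp [alpha]
  · have hk : (0 : ℝ) < k := by exact_mod_cast hk
    calc alpha k l ≤ (k : ℝ) ^ l / l.factorial * ((l : ℝ) / k) ^ l :=
          mul_le_mul_of_nonneg_right (Nat.choose_le_pow_div l k) (by positivity)
      _ = _ := by rw [div_pow]; field_simp

end SetDist

theorem mainTheorem7 :
    (∀ (n k l : ℕ) (μ : SetDist.KSubset n k → ℝ),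
      μ ∈ stdSimplex ℝ (SetDist.KSubset n k) →
      SetDist.IsLogConcave (SetDist.genPoly μ) →
      ∀ T : Finset (Fin n), T.card = l → l ≤ k →
        SetDist.prob μ (fun S => T ⊆ S) ≤
          SetDist.alpha k l * ∏ i ∈ T, SetDist.prob μ (fun S => i ∈ S)) ∧
    (∀ k l : ℕ, l ≤ k → SetDist.alpha k l ≤ (l : ℝ) ^ l / (l.factorial : ℝ)) ∧
    (∀ k : ℕ, 2 ≤ k → SetDist.alpha k 2 ≤ 2) ∧
    (∀ k l : ℕ, l ≤ k → SetDist.alpha k l ≤ Real.exp (l : ℝ)) := by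
  refine ⟨?_, fun k l => SetDist.alpha_le_pow_div_factorial, fun k hk => ?_, fun k l hl => ?_⟩
  · rintro n k l μ hμ h T rfl hT
    exact SetDist.prob_subset_le hμ h T hT
  · exact (SetDist.alpha_le_pow_div_factorial hk).trans_eq (by norm_num [Nat.factorial])
  · exact (SetDist.alpha_le_pow_div_factorial hl).trans
      (Real.pow_div_factorial_le_exp _ (Nat.cast_nonneg l) l)
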